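/- Let $K$ be a field, $\Gamma$ a totally ordered abelian group and $v:K\to\Gamma\cup\{\infty\}$ a surjective valuation with valuation ring $O_v$, maximal ideal $m_v$ and residue field $k_v=O_v/m_v$. Let $A$ be an (associative, unital) $K$-algebra generated by $a_1,\dots,a_n$, let $\pi:K\langle X_1,\dots,X_n\rangle\to A$, $X_i\mapsto a_i$, let $\mathcal R=\ker\pi$, and let $\Lambda=\pi(O_v\langle X_1,\dots,X_n\rangle)\subseteq A$. Assume that $A$ has a finite PBW-basis, i.e. there are $b_1,\dots,b_m\in A$ (for instance $b_i=a_i$) such that the ordered monomials $b_1^{e_1}\cdots b_m^{e_m}$, $(e_1,\dots,e_m)\in\mathbb N^m$, form a $K$-basis of $A$, and assume that at least one of the following holds: (a) $A$ is connected positively graded, $A=K\oplus A_1\oplus A_2\oplus\cdots$, and each $a_i$ is homogeneous; (b) the ordered monomials $b_1^{e_1}\cdots b_m^{e_m}$ also form an $O_v$-basis of $\Lambda$ (as for the Weyl algebras with their usual generators). Assume finally that $A$ is an Ore domain (the left Ore condition is enough) and let $Q=Q_{cl}(A)$ be its skewfield of (left) fractions. (i) If the ring $\Lambda/m_v\Lambda$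 is a domain, then $v$ extends to $Q$: there is a valuation $w:Q\to\Gamma\cup\{\infty\}$ with $w|_K=v$. (ii) Let $p_1,\dots,p_d\in O_v\langle X_1,\dots,X_n\rangle$ generate $\mathcal R$ as a two-sided ideal of $K\langle X_1,\dots,X_n\rangle$. Suppose that $\Lambda$ defines a good reduction of $A$, i.e. the image of $\mathcal R\cap O_v\langle X_1,\dots,X_n\rangle$ in $k_v\langle X_1,\dots,X_n\rangle$ is the two-sided ideal generated by the residues $\overline{p_1},\dots,\overline{p_d}$, and that $A(k_v)=k_v\langle X_1,\dots,X_n\rangle/(\overline{p_1},\dots,\overline{p_d})$ is a domain. Then $v$ extends to $Q$ in the same sense. -/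

import Mathlib

noncomputable section

namespace ValuationExtension

section Valuation

variable {K Γ : Type*} [Field K] [AddCommGroup Γ] [LinearOrder Γ] [IsOrderedAddMonoid Γ]

/-- The valuation ring `O_v = {x ∈ K : v x ≥ 0}` of a (Krull) valuation `v : K → Γ ∪ {∞}`.
Its maximal ideal `m_v` and its residue field `k_v` are Mathlib's `IsLocalRing.maximalIdeal` and
`IsLocalRing.ResidueField`. -/
def integers (v : AddValuation K (WithTop Γ)) : ValuationSubring K where
  carrier := {x | 0 ≤ v x}
  mul_mem' {x y} hx hy := by
    simp only [Set.mem_ofPred_eq] at *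
    rw [v.map_mul]; exact add_nonneg hx hy
  one_mem' := by simp
  add_mem' {x y} hx hy := v.map_le_add hx hy
  zero_mem' := by simp
  neg_mem' {x} hx := by simpa [v.map_neg] using hx
  mem_or_inv_mem' x := by
    by_cases h0 : x = 0
    · left; simp [h0]
    · rcases le_total 0 (v x) with h | h
      · exact Or.inl h
      · right
        have h1 : v x + v x⁻¹ = 0 := by
          rw [← v.map_mul, mul_inv_cancel₀ h0, v.map_one]
        change 0 ≤ v x⁻¹
        calc (0 : WithTop Γ) = v x + v x⁻¹ := h1.symm
          _ ≤ 0 + v x⁻¹ := by gcongr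
          _ = v x⁻¹ := zero_add _

variable {A : Type*} [Ring A] [Algebra K A]
variable (v : AddValuation K (WithTop Γ)) {n m : ℕ} (a : Fin n → A)

/-- The canonical map `π : K⟨X₁,…,Xₙ⟩ → A`, `Xᵢ ↦ aᵢ`. Its kernel is the ideal of relations. -/
def freeMap (K : Type*) [Field K] {A : Type*} [Ring A] [Algebra K A] {n : ℕ} (a : Fin n → A) :
    FreeAlgebra K (Fin n) →+* A :=
  (FreeAlgebra.lift K a).toRingHom

/-- The inclusion `O_v⟨X₁,…,Xₙ⟩ → K⟨X₁,…,Xₙ⟩`. -/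
def freeIncl (n : ℕ) : FreeAlgebra (integers v) (Fin n) →+* FreeAlgebra K (Fin n) :=
  (FreeAlgebra.lift (integers v) (FreeAlgebra.ι K)).toRingHom

/-- Coefficientwise reduction `O_v⟨X₁,…,Xₙ⟩ → k_v⟨X₁,…,Xₙ⟩` modulo `m_v`. -/
def freeRed (n : ℕ) : FreeAlgebra (integers v) (Fin n) →+*
    FreeAlgebra (IsLocalRing.ResidueField (integers v)) (Fin n) :=
  (FreeAlgebra.lift (integers v)
    (FreeAlgebra.ι (IsLocalRing.ResidueField (integers v)))).toRingHom

/-- The subring `Λ = π(O_v⟨X₁,…,Xₙ⟩)` of `A`. -/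
def lattice : Subring A := ((freeMap K a).comp (freeIncl v n)).range

/-- The two-sided ideal `m_v Λ` of `Λ`. (Scalars are central, so the two-sided ideal generated by
`m_v` is the set of finite sums `∑ cᵢ λᵢ` with `cᵢ ∈ m_v` and `λᵢ ∈ Λ`.) -/
def latticeMaxIdeal : TwoSidedIdeal (lattice v a) :=
  TwoSidedIdeal.span {x | ∃ c ∈ IsLocalRing.maximalIdeal (integers v),
    (x : A) = algebraMap K A (c : K)}

/-- The reduction `Λ / m_v Λ`. -/
abbrev Reduction : Type _ := (latticeMaxIdeal v a).ringCon.Quotient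

/-- The ordered monomial `b₁^{e₁} b₂^{e₂} ⋯ bₘ^{eₘ}`. -/
def orderedMonomial (b : Fin m → A) (e : Fin m → ℕ) : A :=
  (List.ofFn fun i => b i ^ e i).prod

/-- `b₁,…,bₘ` give a (finite) PBW-basis of `A`: the ordered monomials in them, one for each
exponent vector, form a `K`-basis of `A`. -/
structure IsPBWBasis (K : Type*) [Field K] {A : Type*} [Ring A] [Algebra K A] {m : ℕ}
    (b : Fin m → A) : Prop where
  linearIndependent : LinearIndependent K (orderedMonomial b)
  span_eq_top : Submodule.span K (Set.range (orderedMonomial b)) = ⊤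

/-- `A` has a positive connected grading `A = K ⊕ A₁ ⊕ A₂ ⊕ ⋯` for which the generators `aᵢ` are
homogeneous. -/
def IsConnectedGraded (K : Type*) [Field K] {A : Type*} [Ring A] [Algebra K A] {n : ℕ}
    (a : Fin n → A) : Prop :=
  ∃ 𝒜 : ℕ → Submodule K A, Nonempty (GradedAlgebra 𝒜) ∧ 𝒜 0 = 1 ∧
    ∀ i, SetLike.IsHomogeneousElem 𝒜 (a i)

/-- The ordered monomials in `b₁,…,bₘ` lie in `Λ` and span it over `O_v`. Together with
`IsPBWBasis K b` this says that they form an `O_v`-basis of `Λ`. -/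
def IsIntegralPBW (b : Fin m → A) : Prop :=
  (Submodule.span (integers v) (Set.range (orderedMonomial b)) : Set A) = lattice v a

/-- The algebra `A(k_v) = k_v⟨X₁,…,Xₙ⟩ / (p̄₁,…,p̄_d)` defined over the residue field by the same
relations `p₁,…,p_d ∈ O_v⟨X₁,…,Xₙ⟩`. -/
abbrev ResidueAlgebra {n d : ℕ} (p : Fin d → FreeAlgebra (integers v) (Fin n)) : Type _ :=
  (TwoSidedIdeal.span (Set.range fun i => freeRed v n (p i))).ringCon.Quotient

/-- With `p₁,…,p_d ∈ O_v⟨X₁,…,Xₙ⟩` generating the ideal `R` of relations of `A` as a two-sided ideal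
of `K⟨X₁,…,Xₙ⟩`, `Λ` defines a good reduction of `A`: the image `R̄` of `R ∩ O_v⟨X₁,…,Xₙ⟩` in
`k_v⟨X₁,…,Xₙ⟩` is the two-sided ideal generated by the residues `p̄₁,…,p̄_d`. -/
structure IsGoodReduction {d : ℕ} (p : Fin d → FreeAlgebra (integers v) (Fin n)) : Prop where
  generates : TwoSidedIdeal.span (Set.range fun i => freeIncl v n (p i)) =
    TwoSidedIdeal.ker (freeMap K a)
  reduces : freeRed v n '' {f | freeMap K a (freeIncl v n f) = 0} =
    (TwoSidedIdeal.span (Set.range fun i => freeRed v n (p i)) :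
      Set (FreeAlgebra (IsLocalRing.ResidueField (integers v)) (Fin n)))

/-- `v` extends to the skewfield of fractions `Q = Q_cl(A)` of the Ore domain `A`: there is a
valuation `w : Q → Γ ∪ {∞}` whose restriction to `K` is `v`. -/
def ExtendsToFractions (A : Type*) [Ring A] [Algebra K A]
    [OreLocalization.OreSet (nonZeroDivisors A)] : Prop :=
  ∃ w : AddValuation (OreLocalization (nonZeroDivisors A) A) (WithTop Γ),
    ∀ x : K, w (OreLocalization.numeratorHom (algebraMap K A x)) = v x

end Valuation

end ValuationExtension

end

/-! Call an element of `Λ` primitive if it lies outside `m_v Λ`. If every nonzero `x` in `A` is `c •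
z` with `c` in `K` and `z` primitive, then `v c` depends only on `x`, and `u x = v c` extends `v` to
`A`. The ultrametric inequality holds because `Λ` is closed under addition. Multiplicativity says
that products of primitive elements are primitive, i.e. that `Λ / m_v Λ` is a domain
(`exists_addValuation`). The passage to `Q` is formal: a left fraction gets the value of its
numerator minus that of its denominator. Such factorizations exist once `Λ` is free over `O_v`: pull
out a coordinate of least value (`exists_smul_notMem_maxMul`). In case (b) freeness is given. In
case (a) `Λ` is the direct sum of finitely generated torsion-free modules over a valuation ring
(`free_of_isConnectedGraded`). Part (ii) has the same core: good reduction identifies `Λ / m_v Λ`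
with `A(k_v)` (`isPrimeLattice_of_isGoodReduction`). -/

namespace ValuationExtension

/-! ### Divisibility in the valuation ring -/

section Integers

variable {K Γ : Type*} [Field K] [AddCommGroup Γ] [LinearOrder Γ] [IsOrderedAddMonoid Γ]
variable (v : AddValuation K (WithTop Γ))

theorem addValuation_div_nonneg {x y : K} (hx : x ≠ 0) (h : v x ≤ v y) : 0 ≤ v (y / x) := by
  have h1 : v x + v x⁻¹ = 0 := by rw [← v.map_mul, mul_inv_cancel₀ hx, v.map_one]
  calc (0 : WithTop Γ) = v x + v x⁻¹ := h1.symm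
    _ ≤ v y + v x⁻¹ := by gcongr
    _ = v (y / x) := by rw [← v.map_mul, div_eq_mul_inv]

theorem addValuation_div_pos {x y : K} (hx : x ≠ 0) (h : v x < v y) : 0 < v (y / x) := by
  refine lt_of_le_of_ne (addValuation_div_nonneg v hx h.le) fun h0 => h.ne ?_
  rw [← div_mul_cancel₀ y hx, v.map_mul, ← h0, zero_add]

theorem mem_maximalIdeal_integers (c : integers v) :
    c ∈ IsLocalRing.maximalIdeal (integers v) ↔ 0 < v (c : K) := by
  rw [IsLocalRing.mem_maximalIdeal, mem_nonunits_iff]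
  constructor
  · intro h
    refine lt_of_le_of_ne c.2 fun h0 => h ?_
    have hc : (c : K) ≠ 0 := by
      intro hc
      rw [hc, v.map_zero] at h0
      exact WithTop.zero_ne_top h0
    have h1 : 0 ≤ v ((1 : K) / c) := addValuation_div_nonneg v hc (by rw [← h0, v.map_one])
    refine IsUnit.of_mul_eq_one (⟨1 / c, h1⟩ : integers v) (Subtype.ext ?_)
    exact mul_one_div_cancel hc
  · intro h hu
    obtain ⟨d, hd⟩ := hu.exists_right_inv
    have h1 : v (c : K) + v (d : K) = 0 := by
      rw [← v.map_mul, ← v.map_one]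
      exact congrArg (fun z : integers v => v (z : K)) hd
    exact absurd h1 (add_pos_of_pos_of_nonneg h d.2).ne'

theorem integers_dvd {x y : integers v} (h : v (x : K) ≤ v (y : K)) : x ∣ y := by
  by_cases hx : (x : K) = 0
  · rw [hx, v.map_zero, top_le_iff] at h
    have hy : (y : K) = 0 := (AddValuation.top_iff v).1 h
    exact ⟨0, Subtype.ext (by simp [hy])⟩
  · exact ⟨⟨y / x, addValuation_div_nonneg v hx h⟩, Subtype.ext (mul_div_cancel₀ _ hx).symm⟩

end Integers

/-! ### From a lattice with prime reduction to a valuation on `A` -/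

section Subalgebra

variable {K Γ : Type*} [Field K] [AddCommGroup Γ] [LinearOrder Γ] [IsOrderedAddMonoid Γ]
variable {A : Type*} [Ring A] [Algebra K A]
variable (v : AddValuation K (WithTop Γ)) (Λ : Subalgebra (integers v) A)

/-- `m_v Λ` as an `O_v`-submodule of `A`. -/
abbrev maxMul : Submodule (integers v) A :=
  IsLocalRing.maximalIdeal (integers v) • Subalgebra.toSubmodule Λ

variable {v Λ}

theorem smul_mem_of_nonneg {c : K} (hc : 0 ≤ v c) {x : A} (hx : x ∈ Λ) : c • x ∈ Λ :=
  Λ.smul_mem hx (⟨c, hc⟩ : integers v)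

theorem smul_mem_maxMul {c : K} (hc : 0 < v c) {x : A} (hx : x ∈ Λ) : c • x ∈ maxMul v Λ :=
  Submodule.smul_mem_smul (r := (⟨c, hc.le⟩ : integers v))
    ((mem_maximalIdeal_integers v _).2 hc) hx

theorem maxMul_le : maxMul v Λ ≤ Subalgebra.toSubmodule Λ := Submodule.smul_le_right

theorem mul_mem_maxMul_left {x y : A} (hx : x ∈ Λ) (hy : y ∈ maxMul v Λ) :
    x * y ∈ maxMul v Λ := by
  induction hy using Submodule.smul_induction_on' with
  | smul c hc z hz =>
    rw [mul_smul_comm]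
    exact Submodule.smul_mem_smul hc (Λ.mul_mem hx hz)
  | add y _ z _ hy hz =>
    rw [mul_add]
    exact Submodule.add_mem _ hy hz

theorem mul_mem_maxMul_right {x y : A} (hx : x ∈ maxMul v Λ) (hy : y ∈ Λ) :
    x * y ∈ maxMul v Λ := by
  induction hx using Submodule.smul_induction_on' with
  | smul c hc z hz =>
    rw [smul_mul_assoc]
    exact Submodule.smul_mem_smul hc (Λ.mul_mem hz hy)
  | add x _ z _ hx hz =>
    rw [add_mul]
    exact Submodule.add_mem _ hx hz

/-- Applied to coordinate functionals, this shows that an element with a coordinate equal to 1 is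
primitive. -/
theorem apply_mem_maximalIdeal (f : Λ →ₗ[integers v] integers v) {z : Λ}
    (hz : (z : A) ∈ maxMul v Λ) : f z ∈ IsLocalRing.maximalIdeal (integers v) := by
  have h1 : z ∈ IsLocalRing.maximalIdeal (integers v) • (⊤ : Submodule (integers v) Λ) := by
    have h2 : (z : A) ∈ Submodule.map (Subalgebra.toSubmodule Λ).subtype
        (IsLocalRing.maximalIdeal (integers v) •
          (⊤ : Submodule (integers v) (Subalgebra.toSubmodule Λ))) := by
      rw [Submodule.map_smul'', Submodule.map_top, Submodule.range_subtype]
      exact hz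
    obtain ⟨z', hz', h3⟩ := h2
    obtain rfl : z' = z := Subtype.ext h3
    exact hz'
  clear hz
  induction h1 using Submodule.smul_induction_on' with
  | smul c hc y _ =>
    rw [map_smul]
    exact Ideal.mul_mem_right _ _ hc
  | add x _ y _ hx hy =>
    rw [map_add]
    exact Ideal.add_mem _ hx hy

/-- In a free lattice every nonzero element is a scalar multiple of a primitive one. -/
theorem exists_smul_notMem_maxMul [Module.Free (integers v) Λ] {y : A} (hy : y ∈ Λ)
    (hy0 : y ≠ 0) : ∃ c : K, ∃ z ∈ Λ, z ∉ maxMul v Λ ∧ y = c • z := by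
  classical
  let B := Module.Free.chooseBasis (integers v) Λ
  let y' : Λ := ⟨y, hy⟩
  have hs : (B.repr y').support.Nonempty := by
    rw [Finsupp.support_nonempty_iff]
    intro h
    exact hy0 (congrArg Subtype.val (B.repr.map_eq_zero_iff.1 h))
  -- A coordinate of least value divides all the others, so it can be factored out, leaving `z` with
  -- `j`-th coordinate 1.
  obtain ⟨j, hj, hmin⟩ := Finset.exists_min_image (B.repr y').support
    (fun i => v (B.repr y' i : K)) hs
  choose! w hw using fun i hi => integers_dvd v (hmin i hi)
  let z : Λ := ∑ i ∈ (B.repr y').support, w i • B i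
  have hyz : y' = B.repr y' j • z := by
    conv_lhs => rw [← B.linearCombination_repr y', Finsupp.linearCombination_apply, Finsupp.sum]
    rw [Finset.smul_sum]
    refine Finset.sum_congr rfl fun i hi => ?_
    rw [hw i hi, mul_smul]
  refine ⟨B.repr y' j, z, z.2, fun hz => ?_, congrArg Subtype.val hyz⟩
  have h1 : B.coord j z ∈ IsLocalRing.maximalIdeal (integers v) := apply_mem_maximalIdeal _ hz
  have h2 : B.repr y' j = B.repr y' j * B.coord j z := by
    conv_lhs => rw [hyz, map_smul]
    rfl
  have h3 : B.coord j z = 1 :=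
    (mul_left_cancel₀ (Finsupp.mem_support_iff.1 hj) (h2.symm.trans (mul_one _).symm))
  rw [h3] at h1
  exact (Ideal.ne_top_iff_one _).1 (IsLocalRing.maximalIdeal.isMaximal _).ne_top h1

/-- Otherwise `c / d` has positive value and `y = (c / d) • x` falls into `m_v Λ`. Used in both
directions it makes `u` well defined; since `x` need not be primitive, it also gives the ultrametric
inequality. -/
theorem le_of_smul_eq_smul {c d : K} {x y z : A} (hx : x ∈ Λ) (hy : y ∉ maxMul v Λ)
    (hz0 : z ≠ 0) (hc : z = c • x) (hd : z = d • y) : v c ≤ v d := by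
  by_contra! h
  have hd0 : d ≠ 0 := by
    rintro rfl
    exact hz0 (by rw [hd, zero_smul])
  refine hy ?_
  have : y = (c / d) • x := by
    rw [div_eq_inv_mul, mul_smul, ← hc, hd, inv_smul_smul₀ hd0]
  rw [this]
  exact smul_mem_maxMul (addValuation_div_pos v hd0 h) hx

/-- If `Λ / m_v Λ` is a domain and every nonzero element of `A` is a scalar multiple of an element
of `Λ` outside `m_v Λ`, then `v` extends to `A`. -/
theorem exists_addValuation (h1 : (1 : A) ∉ maxMul v Λ)
    (hmul : ∀ x ∈ Λ, ∀ y ∈ Λ, x * y ∈ maxMul v Λ → x ∈ maxMul v Λ ∨ y ∈ maxMul v Λ)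
    (hex : ∀ x : A, x ≠ 0 → ∃ c : K, ∃ z ∈ Λ, z ∉ maxMul v Λ ∧ x = c • z) :
    ∃ u : AddValuation A (WithTop Γ),
      (∀ c : K, u (algebraMap K A c) = v c) ∧ ∀ x : A, u x = ⊤ → x = 0 := by
  classical
  choose! C Z hZ hZ' hCZ using hex
  have h10 : (1 : A) ≠ 0 := fun h => h1 (h ▸ Submodule.zero_mem _)
  let f : A → WithTop Γ := fun x => if x = 0 then ⊤ else v (C x)
  have hf0 : f 0 = ⊤ := if_pos rfl
  have hf : ∀ {x : A}, x ≠ 0 → f x = v (C x) := fun h => if_neg h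
  have hfeq : ∀ {x z : A} {c : K}, x ≠ 0 → z ∈ Λ → z ∉ maxMul v Λ → x = c • z → f x = v c := by
    intro x z c hx hz hz' hc
    rw [hf hx]
    exact le_antisymm (le_of_smul_eq_smul (hZ x hx) hz' hx (hCZ x hx) hc)
      (le_of_smul_eq_smul hz (hZ' x hx) hx hc (hCZ x hx))
  have hC0 : ∀ {x : A}, x ≠ 0 → C x ≠ 0 := fun {x} hx h => hx (by rw [hCZ x hx, h, zero_smul])
  have hfalg : ∀ c : K, f (algebraMap K A c) = v c := by
    intro c
    by_cases hc : c = 0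
    · rw [hc, map_zero, hf0, v.map_zero]
    · refine hfeq ?_ Λ.one_mem h1 (Algebra.algebraMap_eq_smul_one c)
      intro h
      refine h10 ?_
      rw [← inv_smul_smul₀ hc (1 : A), ← Algebra.algebraMap_eq_smul_one, h, smul_zero]
  have hadd_aux : ∀ {x y : A}, x ≠ 0 → x + y ≠ 0 → f x ≤ f y → f x ≤ f (x + y) := by
    intro x y hx hxy hle
    -- The scalar of smaller value is a common factor: `x + y = C x • (Z x + z)` with `Z x + z` in
    -- `Λ`.
    obtain ⟨z, hz, hyz⟩ : ∃ z ∈ Λ, y = C x • z := by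
      by_cases hy : y = 0
      · exact ⟨0, Λ.zero_mem, by rw [hy, smul_zero]⟩
      · rw [hf hx, hf hy] at hle
        refine ⟨(C y / C x) • Z y, smul_mem_of_nonneg
          (addValuation_div_nonneg v (hC0 hx) hle) (hZ y hy), ?_⟩
        rw [smul_smul, mul_div_cancel₀ _ (hC0 hx), ← hCZ y hy]
    rw [hf hx, hf hxy]
    refine le_of_smul_eq_smul (Λ.add_mem (hZ x hx) hz) (hZ' _ hxy) hxy ?_ (hCZ _ hxy)
    rw [smul_add, ← hyz, ← hCZ x hx]
  have hadd : ∀ x y, min (f x) (f y) ≤ f (x + y) := by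
    intro x y
    by_cases hxy : x + y = 0
    · rw [hxy, hf0]; exact le_top
    by_cases hx : x = 0
    · rw [hx, zero_add]; exact min_le_right _ _
    by_cases hy : y = 0
    · rw [hy, add_zero]; exact min_le_left _ _
    rcases le_total (f x) (f y) with h | h
    · rw [min_eq_left h]; exact hadd_aux hx hxy h
    · rw [min_eq_right h, add_comm x y]
      exact hadd_aux hy (by rwa [add_comm]) h
  have hfmul : ∀ x y, f (x * y) = f x + f y := by
    intro x y
    by_cases hx : x = 0
    · rw [hx, zero_mul, hf0, top_add]
    by_cases hy : y = 0
    · rw [hy, mul_zero, hf0, add_top]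
    have hnot : Z x * Z y ∉ maxMul v Λ := fun h =>
      (hmul _ (hZ x hx) _ (hZ y hy) h).elim (hZ' x hx) (hZ' y hy)
    have hprod : x * y = (C x * C y) • (Z x * Z y) := by
      rw [← smul_mul_smul_comm, ← hCZ x hx, ← hCZ y hy]
    have hxy : x * y ≠ 0 := by
      intro h
      refine hnot ?_
      rw [← inv_smul_smul₀ (mul_ne_zero (hC0 hx) (hC0 hy)) (Z x * Z y), ← hprod, h, smul_zero]
      exact Submodule.zero_mem _
    rw [hfeq hxy (Λ.mul_mem (hZ x hx) (hZ y hy)) hnot hprod, v.map_mul, hf hx, hf hy]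
  refine ⟨AddValuation.of f hf0 ?_ hadd hfmul, hfalg, fun x hx => ?_⟩
  · rw [← map_one (algebraMap K A), hfalg, v.map_one]
  · by_contra h
    change f x = ⊤ at hx
    rw [hf h] at hx
    exact hC0 h ((AddValuation.top_iff v).1 hx)

end Subalgebra

/-! ### Extension to the skewfield of fractions -/

section Ore

open OreLocalization nonZeroDivisors

/-- A valuation with trivial support extends to the localization at the nonzerodivisors. -/
theorem exists_valuation_oreLocalization {A Γ₀ : Type*} [Ring A] [Nontrivial A]
    [OreSet (nonZeroDivisors A)] [LinearOrderedCommGroupWithZero Γ₀] (u : Valuation A Γ₀)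
    (hu : ∀ x, u x = 0 → x = 0) :
    ∃ w : Valuation (OreLocalization (nonZeroDivisors A) A) Γ₀,
      ∀ x, w (numeratorHom x) = u x := by
  have hne : ∀ s : nonZeroDivisors A, u s ≠ 0 := fun s h => nonZeroDivisors.coe_ne_zero s (hu _ h)
  let fS : nonZeroDivisors A →* Γ₀ˣ :=
    { toFun := fun s => Units.mk0 (u s) (hne s)
      map_one' := by ext; simp
      map_mul' := fun s t => by ext; simp }
  let W : OreLocalization (nonZeroDivisors A) A →* Γ₀ :=
    universalMulHom (u : A →* Γ₀) fS fun s => rfl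
  have hW : ∀ (r : A) (s : nonZeroDivisors A), W (r /ₒ s) = (u s)⁻¹ * u r := fun r s => by
    refine (universalMulHom_apply _ _ _).trans ?_
    rw [Units.val_inv_eq_inv_val]
    rfl
  refine ⟨⟨⟨⟨W, ?_⟩, W.map_one, W.map_mul⟩, ?_⟩, fun x => ?_⟩
  · change W 0 = 0
    rw [← OreLocalization.zero_oreDiv (1 : nonZeroDivisors A), hW, u.map_zero, mul_zero]
  · intro x y
    change W (x + y) ≤ max (W x) (W y)
    induction x using OreLocalization.ind with | _ r s
    induction y using OreLocalization.ind with | _ r' s'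
    -- The Ore condition `s'' * s = r'' * s'` gives a common left denominator, which reduces the
    -- inequality to the one for `u` on numerators.
    obtain ⟨r'', s'', h, -⟩ := oreDivAddChar' r r' s s'
    have hmem : r'' * (s' : A) ∈ nonZeroDivisors A := by
      rw [← h]; exact (s'' * s).2
    have hs : s'' * s = ⟨r'' * s', hmem⟩ := Subtype.ext h
    rw [OreLocalization.expand r' s' r'' hmem, OreLocalization.expand' r s s'', ← hs, add_oreDiv,
      hW, hW, hW, le_max_iff]
    exact (le_max_iff.1 (u.map_add _ _)).imp (mul_le_mul_right · _) (mul_le_mul_right · _)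
  · exact universalMulHom_commutes (u : A →* Γ₀) fS fun s => rfl

theorem extendsToFractions_of_addValuation {K Γ A : Type*} [Field K]
    [AddCommGroup Γ] [LinearOrder Γ] [IsOrderedAddMonoid Γ] {v : AddValuation K (WithTop Γ)}
    [Ring A] [Nontrivial A] [Algebra K A] [OreSet (nonZeroDivisors A)]
    (h : ∃ u : AddValuation A (WithTop Γ),
      (∀ c : K, u (algebraMap K A c) = v c) ∧ ∀ x : A, u x = ⊤ → x = 0) :
    ExtendsToFractions v A := by
  obtain ⟨u, hu, hu'⟩ := h
  obtain ⟨w, hw⟩ := exists_valuation_oreLocalization (AddValuation.toValuation u) hu'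
  exact ⟨AddValuation.ofValuation w, fun x => (hw _).trans (hu x)⟩

end Ore

/-! ### The reduction of `Λ` and its comparison with `A(k_v)` -/

section Lattice

variable {K Γ : Type*} [Field K] [AddCommGroup Γ] [LinearOrder Γ] [IsOrderedAddMonoid Γ]
variable {A : Type*} [Ring A] [Algebra K A]
variable (v : AddValuation K (WithTop Γ)) {n : ℕ} (a : Fin n → A)

/-- `Λ` as an `O_v`-subalgebra of `A`. -/
abbrev latticeAlgebra : Subalgebra (integers v) A := Algebra.adjoin (integers v) (Set.range a)

theorem freeMap_freeIncl (f : FreeAlgebra (integers v) (Fin n)) :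
    freeMap K a (freeIncl v n f) = FreeAlgebra.lift (integers v) a f := by
  have h : ((FreeAlgebra.lift K a).restrictScalars (integers v)).comp
      (FreeAlgebra.lift (integers v) (FreeAlgebra.ι K)) = FreeAlgebra.lift (integers v) a := by
    ext i
    simp
  exact DFunLike.congr_fun h f

theorem mem_lattice_iff (x : A) : x ∈ lattice v a ↔ x ∈ latticeAlgebra v a := by
  rw [latticeAlgebra, Algebra.adjoin_range_eq_range_freeAlgebra_lift]
  constructor
  · rintro ⟨f, rfl⟩
    exact ⟨f, (freeMap_freeIncl v a f).symm⟩
  · rintro ⟨f, rfl⟩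
    exact ⟨f, freeMap_freeIncl v a f⟩

/-- Scalars are central, so the `O_v`-submodule `m_v Λ` is already a two-sided ideal of `Λ`. -/
theorem mem_latticeMaxIdeal_iff (x : lattice v a) :
    x ∈ latticeMaxIdeal v a ↔ (x : A) ∈ maxMul v (latticeAlgebra v a) := by
  constructor
  · intro hx
    let I : TwoSidedIdeal (lattice v a) := TwoSidedIdeal.mk'
      {y | (y : A) ∈ maxMul v (latticeAlgebra v a)} (maxMul v (latticeAlgebra v a)).zero_mem
      (fun hx hy => (maxMul v (latticeAlgebra v a)).add_mem hx hy) (fun hx => (maxMul v (latticeAlgebra v a)).neg_mem hx)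
      (fun {y z} hz => mul_mem_maxMul_left ((mem_lattice_iff v a _).1 y.2) hz)
      (fun {y z} hy => mul_mem_maxMul_right hy ((mem_lattice_iff v a _).1 z.2))
    have hI : ∀ y, y ∈ I ↔ (y : A) ∈ maxMul v (latticeAlgebra v a) := fun y =>
      TwoSidedIdeal.mem_mk' {y : lattice v a | (y : A) ∈ maxMul v (latticeAlgebra v a)}
        _ _ _ _ _ y
    refine (hI x).1 (TwoSidedIdeal.mem_span_iff.1 hx I ?_)
    rintro y ⟨c, hc, hy⟩
    refine (hI y).2 ?_
    rw [hy, Algebra.algebraMap_eq_smul_one]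
    exact Submodule.smul_mem_smul hc (latticeAlgebra v a).one_mem
  · obtain ⟨x, hxL⟩ := x
    intro (hx : x ∈ maxMul v (latticeAlgebra v a))
    induction hx using Submodule.smul_induction_on' with
    | smul c hc y hy =>
      have hc' : algebraMap K A (c : K) ∈ lattice v a :=
        (mem_lattice_iff v a _).2 ((latticeAlgebra v a).algebraMap_mem c)
      have hmem : (⟨_, hc'⟩ : lattice v a) ∈ latticeMaxIdeal v a :=
        TwoSidedIdeal.subset_span ⟨c, hc, rfl⟩
      have := TwoSidedIdeal.mul_mem_right _ _ ⟨y, (mem_lattice_iff v a _).2 hy⟩ hmem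
      convert this using 1
      exact Subtype.ext (Algebra.smul_def (c : K) y)
    | add y hy z hz ihy ihz =>
      exact TwoSidedIdeal.add_mem _ (ihy ((mem_lattice_iff v a _).2 (maxMul_le hy)))
        (ihz ((mem_lattice_iff v a _).2 (maxMul_le hz)))

theorem quotient_mk_eq_zero_iff {R : Type*} [Ring R] (I : TwoSidedIdeal R) (x : R) :
    I.ringCon.mk' x = 0 ↔ x ∈ I := by
  rw [TwoSidedIdeal.mem_iff, ← map_zero I.ringCon.mk']
  exact RingCon.eq I.ringCon

theorem one_notMem_of_isDomain {R : Type*} [Ring R] (I : TwoSidedIdeal R)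
    [IsDomain I.ringCon.Quotient] : (1 : R) ∉ I := fun h =>
  one_ne_zero (α := I.ringCon.Quotient) ((map_one I.ringCon.mk').symm.trans
    ((quotient_mk_eq_zero_iff I 1).2 h))

theorem mem_or_mem_of_isDomain {R : Type*} [Ring R] (I : TwoSidedIdeal R)
    [IsDomain I.ringCon.Quotient] {x y : R} (h : x * y ∈ I) : x ∈ I ∨ y ∈ I := by
  rw [← quotient_mk_eq_zero_iff, map_mul] at h
  exact (mul_eq_zero.1 h).imp (quotient_mk_eq_zero_iff I x).1 (quotient_mk_eq_zero_iff I y).1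

variable {v} in
/-- The lattice `Λ` modulo `m_v Λ` is a domain. -/
structure IsPrimeLattice (Λ : Subalgebra (integers v) A) : Prop where
  one_notMem : (1 : A) ∉ maxMul v Λ
  mem_or_mem : ∀ x ∈ Λ, ∀ y ∈ Λ, x * y ∈ maxMul v Λ → x ∈ maxMul v Λ ∨ y ∈ maxMul v Λ

theorem isPrimeLattice_of_isDomain_reduction [IsDomain (Reduction v a)] :
    IsPrimeLattice (latticeAlgebra v a) where
  one_notMem h := one_notMem_of_isDomain (latticeMaxIdeal v a)
    ((mem_latticeMaxIdeal_iff v a 1).2 h)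
  mem_or_mem x hx y hy h := by
    let x' : lattice v a := ⟨x, (mem_lattice_iff v a x).2 hx⟩
    let y' : lattice v a := ⟨y, (mem_lattice_iff v a y).2 hy⟩
    have h1 : x' * y' ∈ latticeMaxIdeal v a := (mem_latticeMaxIdeal_iff v a _).2 h
    exact (mem_or_mem_of_isDomain _ h1).imp (mem_latticeMaxIdeal_iff v a x').1
      (mem_latticeMaxIdeal_iff v a y').1

theorem lift_basisFreeMonoid {R S : Type*} [CommRing R] [Ring S] [Algebra R S] {X : Type*}
    (g : X → S) (w : FreeMonoid X) :
    FreeAlgebra.lift R g (FreeAlgebra.basisFreeMonoid R X w) = FreeMonoid.lift g w := by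
  have h : FreeAlgebra.basisFreeMonoid R X w = FreeMonoid.lift (FreeAlgebra.ι R) w := by
    change MonoidAlgebra.lift R (FreeAlgebra R X) (FreeMonoid X) (FreeMonoid.lift (FreeAlgebra.ι R))
      (MonoidAlgebra.of R _ w) = _
    rw [MonoidAlgebra.lift_of]
  rw [h]
  refine (FreeMonoid.hom_map_lift
    (FreeAlgebra.lift R g : FreeAlgebra R X →* S) (FreeAlgebra.ι R) w).trans ?_
  congr 2
  ext x
  exact FreeAlgebra.lift_ι_apply g x

/-- The kernel of the coefficientwise reduction consists of the elements with coefficients in the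
maximal ideal. -/
theorem mem_smul_top_of_freeRed_eq_zero {f : FreeAlgebra (integers v) (Fin n)}
    (hf : freeRed v n f = 0) : f ∈ IsLocalRing.maximalIdeal (integers v) •
      (⊤ : Submodule (integers v) (FreeAlgebra (integers v) (Fin n))) := by
  let k := IsLocalRing.ResidueField (integers v)
  let B := FreeAlgebra.basisFreeMonoid (integers v) (Fin n)
  let B' := FreeAlgebra.basisFreeMonoid k (Fin n)
  have hB : ∀ w, freeRed v n (B w) = B' w := fun w => by
    refine (lift_basisFreeMonoid _ w).trans ?_
    rw [← lift_basisFreeMonoid (R := k)]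
    exact DFunLike.congr_fun (FreeAlgebra.lift_comp_ι (AlgHom.id k (FreeAlgebra k (Fin n)))) _
  have hsum := B.linearCombination_repr f
  rw [Finsupp.linearCombination_apply, Finsupp.sum] at hsum
  have hred : ∑ w ∈ (B.repr f).support, IsLocalRing.residue (integers v) (B.repr f w) • B' w
      = 0 := by
    rw [← hf]
    conv_rhs => rw [← hsum, map_sum]
    refine Finset.sum_congr rfl fun w _ => ?_
    rw [← hB]
    exact (map_smul (FreeAlgebra.lift (integers v) (FreeAlgebra.ι k)) _ _).symm
  rw [← hsum]
  -- Words are independent over `k_v`, so every coefficient has residue zero.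
  refine Submodule.sum_mem _ fun w hw => Submodule.smul_mem_smul ?_ trivial
  rw [← IsLocalRing.residue_eq_zero_iff]
  exact linearIndependent_iff'.1 B'.linearIndependent _ _ hred w hw

theorem freeRed_eq_zero_of_mem {f : FreeAlgebra (integers v) (Fin n)}
    (hf : f ∈ IsLocalRing.maximalIdeal (integers v) •
      (⊤ : Submodule (integers v) (FreeAlgebra (integers v) (Fin n)))) : freeRed v n f = 0 := by
  induction hf using Submodule.smul_induction_on' with
  | smul c hc y _ =>
    refine (map_smul (FreeAlgebra.lift (integers v)
      (FreeAlgebra.ι (IsLocalRing.ResidueField (integers v)))) c y).trans ?_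
    rw [← algebraMap_smul (IsLocalRing.ResidueField (integers v)) c]
    have : algebraMap (integers v) (IsLocalRing.ResidueField (integers v)) c = 0 :=
      (IsLocalRing.residue_eq_zero_iff c).2 hc
    rw [this, zero_smul]
  | add x _ y _ hx hy => rw [map_add, hx, hy, add_zero]

/-- `m_v Λ` is the image of `m_v O_v⟨X⟩`, which is the kernel of the reduction; so membership means
that `f` can be changed by an element of that kernel into a relation `g` of `A`. -/
theorem lift_mem_maxMul_iff (f : FreeAlgebra (integers v) (Fin n)) :
    FreeAlgebra.lift (integers v) a f ∈ maxMul v (latticeAlgebra v a) ↔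
      ∃ g, FreeAlgebra.lift (integers v) a g = 0 ∧ freeRed v n g = freeRed v n f := by
  have hmap : maxMul v (latticeAlgebra v a) =
      Submodule.map (FreeAlgebra.lift (integers v) a).toLinearMap
        (IsLocalRing.maximalIdeal (integers v) • ⊤) := by
    rw [Submodule.map_smul'', Submodule.map_top, maxMul, latticeAlgebra,
      Algebra.adjoin_range_eq_range_freeAlgebra_lift]
    rfl
  rw [hmap]
  constructor
  · rintro ⟨h, hh, hfh⟩
    refine ⟨f - h, ?_, ?_⟩
    · rw [map_sub, sub_eq_zero]
      exact hfh.symm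
    · rw [map_sub, freeRed_eq_zero_of_mem v hh, sub_zero]
  · rintro ⟨g, hg, hgf⟩
    refine ⟨f - g, mem_smul_top_of_freeRed_eq_zero v (by rw [map_sub, hgf, sub_self]), ?_⟩
    change FreeAlgebra.lift (integers v) a (f - g) = _
    rw [map_sub, hg, sub_zero]

theorem isPrimeLattice_of_isGoodReduction {d : ℕ}
    {p : Fin d → FreeAlgebra (integers v) (Fin n)} (hp : IsGoodReduction v a p)
    [IsDomain (ResidueAlgebra v p)] : IsPrimeLattice (latticeAlgebra v a) := by
  let I := TwoSidedIdeal.span (Set.range fun i => freeRed v n (p i))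
  have key : ∀ f, FreeAlgebra.lift (integers v) a f ∈ maxMul v (latticeAlgebra v a) ↔
      freeRed v n f ∈ I := by
    intro f
    rw [lift_mem_maxMul_iff, ← SetLike.mem_coe, ← hp.reduces]
    simp only [freeMap_freeIncl]
    rfl
  refine ⟨fun h => ?_, fun x hx y hy h => ?_⟩
  · rw [← map_one (FreeAlgebra.lift (integers v) a), key, map_one] at h
    exact one_notMem_of_isDomain I h
  · rw [latticeAlgebra, Algebra.adjoin_range_eq_range_freeAlgebra_lift] at hx hy
    obtain ⟨f, rfl⟩ := hx
    obtain ⟨g, rfl⟩ := hy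
    change FreeAlgebra.lift (integers v) a f * FreeAlgebra.lift (integers v) a g ∈ _ at h
    rw [← map_mul, key, map_mul] at h
    exact (mem_or_mem_of_isDomain I h).imp (key f).2 (key g).2

end Lattice

/-! ### Freeness of `Λ` over `O_v` and conclusion -/

section Free

variable {K Γ : Type*} [Field K] [AddCommGroup Γ] [LinearOrder Γ] [IsOrderedAddMonoid Γ]
variable {A : Type*} [Ring A] [Algebra K A]
variable (v : AddValuation K (WithTop Γ)) {n m : ℕ} (a : Fin n → A)

instance isTorsionFree_integers : Module.IsTorsionFree (integers v) A := by
  have : Module.IsTorsionFree (integers v) K :=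
    (inferInstance : Module.IsTorsionFree (integers v).toSubring K)
  exact Module.IsTorsionFree.trans K

/-- A valuation ring is Bézout, so torsion-free modules are flat; it is local, so finitely generated
flat modules are free. -/
theorem free_of_finite (N : Submodule (integers v) A) [Module.Finite (integers v) N] :
    Module.Free (integers v) N := by
  have : Module.Flat (integers v) N := Module.Flat.flat_iff_torsion_eq_bot_of_isBezout.2
    (Submodule.isTorsionFree_iff_torsion_eq_bot.1 inferInstance)
  exact Module.free_of_flat_of_isLocalRing

theorem free_of_isIntegralPBW {b : Fin m → A} (hb : IsPBWBasis K b)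
    (h : IsIntegralPBW v a b) : Module.Free (integers v) (latticeAlgebra v a) := by
  have hli : LinearIndependent (integers v) (orderedMonomial b) :=
    hb.linearIndependent.restrict_scalars fun c d hcd => Subtype.ext <| by
      simpa [Algebra.smul_def] using hcd
  have hspan : Submodule.span (integers v) (Set.range (orderedMonomial b)) =
      Subalgebra.toSubmodule (latticeAlgebra v a) := by
    ext x
    rw [← SetLike.mem_coe, h, SetLike.mem_coe, mem_lattice_iff]
    rfl
  exact Module.Free.of_basis ((Module.Basis.span hli).map (LinearEquiv.ofEq _ _ hspan))

/-- The `O_v`-span of the words of a given weight. -/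
def wordSpan {ι : Type*} (c : ι → A) (deg : ι → ℕ) (d : ℕ) : Submodule (integers v) A :=
  Submodule.span (integers v) ((fun l : List ι => (l.map c).prod) '' {l | (l.map deg).sum = d})

/-- Positive weights bound the length of a word by its weight, leaving finitely many words. -/
theorem wordSpan_finite {ι : Type*} [Finite ι] (c : ι → A) {deg : ι → ℕ}
    (hdeg : ∀ i, deg i ≠ 0) (d : ℕ) : Module.Finite (integers v) (wordSpan v c deg d) := by
  refine Module.Finite.span_of_finite _ (Set.Finite.image _ ?_)
  refine (List.finite_length_le ι d).subset fun l hl => ?_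
  have h := List.length_le_sum_of_one_le (l.map deg) fun x hx => by
    obtain ⟨i, -, rfl⟩ := List.mem_map.1 hx
    exact Nat.one_le_iff_ne_zero.2 (hdeg i)
  rwa [List.length_map, Set.mem_ofPred_eq.mp hl] at h

theorem iSup_wordSpan {ι : Type*} (c : ι → A) (deg : ι → ℕ) :
    ⨆ d, wordSpan v c deg d =
      Subalgebra.toSubmodule (Algebra.adjoin (integers v) (Set.range c)) := by
  refine le_antisymm (iSup_le fun d => Submodule.span_le.2 ?_) ?_
  · rintro _ ⟨l, -, rfl⟩
    refine Subalgebra.list_prod_mem _ fun x hx => ?_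
    obtain ⟨i, -, rfl⟩ := List.mem_map.1 hx
    exact Algebra.subset_adjoin ⟨i, rfl⟩
  · rw [Algebra.adjoin_eq_span, Submodule.span_le]
    intro x hx
    obtain ⟨l, hl, rfl⟩ := Submonoid.exists_list_of_mem_closure hx
    obtain ⟨l, rfl⟩ : l ∈ Set.range (List.map c) := by
      rw [Set.range_list_map]
      exact hl
    exact Submodule.mem_iSup_of_mem _ (Submodule.subset_span ⟨l, rfl, rfl⟩)

theorem iSupIndep_of_le_graded (𝒜 : ℕ → Submodule K A) [GradedAlgebra 𝒜]
    {D : ℕ → Submodule (integers v) A} (hD : ∀ d, ∀ x ∈ D d, x ∈ 𝒜 d) : iSupIndep D := by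
  intro d
  rw [Submodule.disjoint_def]
  intro x hx hx'
  have hker : ⨆ (j) (_ : j ≠ d), D j ≤
      LinearMap.ker ((GradedAlgebra.proj 𝒜 d).restrictScalars (integers v)) := by
    refine iSup₂_le fun j hj y hy => ?_
    exact DirectSum.decompose_of_mem_ne 𝒜 (hD j y hy) hj
  exact (DirectSum.decompose_of_mem_same 𝒜 (hD d x hx)).symm.trans (hker hx')

theorem free_iSup {D : ℕ → Submodule (integers v) A} (hD : iSupIndep D)
    [∀ d, Module.Free (integers v) (D d)] : Module.Free (integers v) ↥(⨆ d, D d) := by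
  rw [Submodule.iSup_eq_range_dfinsupp_lsum]
  exact Module.Free.of_equiv (LinearEquiv.ofInjective _ hD.dfinsupp_lsum_injective)

theorem free_adjoin_of_graded {ι : Type*} [Finite ι] {c : ι → A} {deg : ι → ℕ}
    (hdeg : ∀ i, deg i ≠ 0) (𝒜 : ℕ → Submodule K A) [GradedAlgebra 𝒜]
    (hc : ∀ i, c i ∈ 𝒜 (deg i)) :
    Module.Free (integers v) (Algebra.adjoin (integers v) (Set.range c)) := by
  have h1 : iSupIndep (wordSpan v c deg) := by
    refine iSupIndep_of_le_graded v 𝒜 fun d x hx => ?_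
    have : wordSpan v c deg d ≤ (𝒜 d).restrictScalars (integers v) := by
      refine Submodule.span_le.2 ?_
      rintro _ ⟨l, rfl, rfl⟩
      exact SetLike.list_prod_map_mem_graded l deg c fun i _ => hc i
    exact this hx
  have h2 : ∀ d, Module.Free (integers v) (wordSpan v c deg d) := fun d =>
    have := wordSpan_finite v c hdeg d
    free_of_finite v _
  have h3 := free_iSup v h1
  rw [iSup_wordSpan] at h3
  exact h3

variable {v a}

/-- A scalar of negative value in `Λ` has its inverse in `m_v`, which would put 1 into `m_v Λ`. -/
theorem nonneg_of_algebraMap_mem {Λ : Subalgebra (integers v) A} (h1 : (1 : A) ∉ maxMul v Λ)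
    {c : K} (hc : algebraMap K A c ∈ Λ) : 0 ≤ v c := by
  by_contra! h
  have hc0 : c ≠ 0 := by
    rintro rfl
    rw [v.map_zero] at h
    exact not_top_lt h
  refine h1 ?_
  have : (1 : A) = (1 / c) • algebraMap K A c := by
    rw [Algebra.algebraMap_eq_smul_one, smul_smul, one_div_mul_cancel hc0, one_smul]
  rw [this]
  exact smul_mem_maxMul (addValuation_div_pos v hc0 (by rwa [v.map_one])) hc

theorem free_of_isConnectedGraded (h1 : (1 : A) ∉ maxMul v (latticeAlgebra v a))
    (h : IsConnectedGraded K a) : Module.Free (integers v) (latticeAlgebra v a) := by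
  obtain ⟨𝒜, ⟨_⟩, h0, ha⟩ := h
  choose deg hdeg using ha
  -- Generators of degree 0 would spoil the finiteness of the graded pieces. They are scalars,
  -- already in `O_v` as `1 ∉ m_v Λ`, and can be dropped.
  have heq : latticeAlgebra v a = Algebra.adjoin (integers v)
      (Set.range fun i : {i // deg i ≠ 0} => a i) := by
    refine le_antisymm (Algebra.adjoin_le ?_) (Algebra.adjoin_mono ?_)
    · rintro _ ⟨i, rfl⟩
      by_cases hi : deg i = 0
      · have hai := hdeg i
        rw [hi, h0] at hai
        obtain ⟨c, hc⟩ := Submodule.mem_one.1 hai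
        have hc' : 0 ≤ v c := nonneg_of_algebraMap_mem h1 (by
          rw [hc]
          exact Algebra.subset_adjoin ⟨i, rfl⟩)
        rw [← hc]
        exact Subalgebra.algebraMap_mem _ (⟨c, hc'⟩ : integers v)
      · exact Algebra.subset_adjoin ⟨⟨i, hi⟩, rfl⟩
    · rintro _ ⟨i, rfl⟩
      exact ⟨i, rfl⟩
  rw [heq]
  exact free_adjoin_of_graded v (fun i : {i // deg i ≠ 0} => i.2) 𝒜 fun i => hdeg i

/-- Clearing denominators: `Λ` spans `A` over `K`. Nonnegativity of `v c` keeps the induction going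
through sums. -/
theorem exists_smul_mem_latticeAlgebra (ha : Algebra.adjoin K (Set.range a) = ⊤) (x : A) :
    ∃ c : K, c ≠ 0 ∧ 0 ≤ v c ∧ c • x ∈ latticeAlgebra v a := by
  have hx : x ∈ Algebra.adjoin K (Set.range a) := ha ▸ Algebra.mem_top
  induction hx using Algebra.adjoin_induction with
  | mem x hx =>
    exact ⟨1, one_ne_zero, v.map_one.ge, by rw [one_smul]; exact Algebra.subset_adjoin hx⟩
  | algebraMap r =>
    rcases (integers v).mem_or_inv_mem r with hr | hr
    · refine ⟨1, one_ne_zero, v.map_one.ge, ?_⟩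
      rw [one_smul]
      exact Subalgebra.algebraMap_mem _ (⟨r, hr⟩ : integers v)
    · by_cases hr0 : r = 0
      · refine ⟨1, one_ne_zero, v.map_one.ge, ?_⟩
        rw [hr0, map_zero, smul_zero]
        exact Subalgebra.zero_mem _
      · refine ⟨r⁻¹, inv_ne_zero hr0, hr, ?_⟩
        rw [Algebra.algebraMap_eq_smul_one, inv_smul_smul₀ hr0]
        exact Subalgebra.one_mem _
  | add x y _ _ hx hy =>
    obtain ⟨c, hc0, hc, hcx⟩ := hx
    obtain ⟨d, hd0, hd, hdy⟩ := hy
    refine ⟨c * d, mul_ne_zero hc0 hd0, by rw [v.map_mul]; exact add_nonneg hc hd, ?_⟩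
    rw [smul_add]
    refine Subalgebra.add_mem _ ?_ ?_
    · rw [mul_comm, mul_smul]
      exact smul_mem_of_nonneg hd hcx
    · rw [mul_smul]
      exact smul_mem_of_nonneg hc hdy
  | mul x y _ _ hx hy =>
    obtain ⟨c, hc0, hc, hcx⟩ := hx
    obtain ⟨d, hd0, hd, hdy⟩ := hy
    refine ⟨c * d, mul_ne_zero hc0 hd0, by rw [v.map_mul]; exact add_nonneg hc hd, ?_⟩
    rw [← smul_mul_smul_comm]
    exact Subalgebra.mul_mem _ hcx hdy

theorem extendsToFractions_of_isPrimeLattice [Nontrivial A]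
    [OreLocalization.OreSet (nonZeroDivisors A)] (ha : Algebra.adjoin K (Set.range a) = ⊤)
    {b : Fin m → A} (hb : IsPBWBasis K b) (hgr : IsConnectedGraded K a ∨ IsIntegralPBW v a b)
    (h : IsPrimeLattice (latticeAlgebra v a)) : ExtendsToFractions v A := by
  have hfree : Module.Free (integers v) (latticeAlgebra v a) :=
    hgr.elim (free_of_isConnectedGraded h.one_notMem) (free_of_isIntegralPBW v a hb)
  refine extendsToFractions_of_addValuation
    (exists_addValuation h.one_notMem h.mem_or_mem fun x hx => ?_)
  obtain ⟨c, hc0, -, hc⟩ := exists_smul_mem_latticeAlgebra (v := v) ha x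
  obtain ⟨d, z, hz, hz', hd⟩ := exists_smul_notMem_maxMul hc (smul_ne_zero hc0 hx)
  refine ⟨c⁻¹ * d, z, hz, hz', ?_⟩
  rw [mul_smul, ← hd, inv_smul_smul₀ hc0]

end Free

end ValuationExtension

theorem mainTheorem1 {K Γ A : Type*} [Field K]
    [AddCommGroup Γ] [LinearOrder Γ] [IsOrderedAddMonoid Γ]
    (v : AddValuation K (WithTop Γ)) (hv : ∀ γ : Γ, ∃ x : K, v x = (γ : WithTop Γ))
    [Ring A] [Algebra K A] [IsDomain A] [OreLocalization.OreSet (nonZeroDivisors A)]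
    {n m : ℕ} (a : Fin n → A) (ha : Algebra.adjoin K (Set.range a) = ⊤)
    (b : Fin m → A) (hb : ValuationExtension.IsPBWBasis K b)
    (hgr : ValuationExtension.IsConnectedGraded K a ∨ ValuationExtension.IsIntegralPBW v a b) :
    (IsDomain (ValuationExtension.Reduction v a) →
      ValuationExtension.ExtendsToFractions v A) ∧
    (∀ (d : ℕ) (p : Fin d → FreeAlgebra (ValuationExtension.integers v) (Fin n)),
      ValuationExtension.IsGoodReduction v a p →
      IsDomain (ValuationExtension.ResidueAlgebra v p) →
      ValuationExtension.ExtendsToFractions v A) :=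
  ⟨fun _ => ValuationExtension.extendsToFractions_of_isPrimeLattice ha hb hgr
      (ValuationExtension.isPrimeLattice_of_isDomain_reduction v a),
    fun _ _ hp _ => ValuationExtension.extendsToFractions_of_isPrimeLattice ha hb hgr
      (ValuationExtension.isPrimeLattice_of_isGoodReduction v a hp)⟩
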